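/- **Setting.** Let $X$ be a set of contexts, $Y$ a set of arms, $\mathcal P\subset X\times Y$ a set of feasible pairs, and $\mathcal D$ a metric on $\mathcal P$ such that some closed ball of radius $1$ centered in $\mathcal P$ is all of $\mathcal P$. Let $\Pi$ be a probability distribution over (jointly measurable) payoff functions $\mathcal P\to[0,1]$, and let $\mu(x,y)=\mathbb E_{\pi\sim\Pi}[\pi(x,y)]$ satisfy $|\mu(p)-\mu(q)|\le \mathcal D(p,q)$ for all $p,q\in\mathcal P$. Contexts $x_1,x_2,\dots\in X$ are fixed in advance. In round $t$ the context $x_t$ is revealed, the algorithm picks an arm $y_t$ with $(x_t,y_t)\in\mathcal P$ using only the past and possibly private randomness, and receives $\pi_t(x_t,y_t)$, where $\pi_t\sim\Pi$ is independent of everything before. Put $\mu^*(x)=\sup_{y:(x,y)\in\mathcal P}\mu(x,y)$ and let the contextual regret be $R(T)=\sum_{t=1}^T\bigl(\mu^*(x_t)-\mu(x_t,y_t)\bigr)$. **Contextual zooming algorithm** with time horizon $T$. It maintains a finite collection of active closed balls, each a pair of a center in $\mathcal P$ and a radius; initially a single ball of radius $1$ that contains $\mathcal P$. For an active ball $B$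 of radius $r(B)$ let $n_t(B)$ be the number of rounds before $t$ in which $B$ was selected, $\nu_t(B)$ the average payoff received in those rounds ($0$ if there are none), $\mathrm{rad}_t(B)=4\sqrt{\log T/(1+n_t(B))}$, $I^{\mathrm{pre}}_t(B)=\nu_t(B)+2r(B)+\mathrm{rad}_t(B)$, and $I_t(B)=\min_{B'}\bigl(I^{\mathrm{pre}}_t(B')+\mathcal D(B,B')\bigr)$, the minimum being over the active balls $B'$ with $r(B')\ge r(B)$ and $\mathcal D(B,B')$ being the distance of the centers. The domain $\mathrm{dom}_t(B)$ is $B$ minus the union of all active balls of strictly smaller radius. In round $t$ the algorithm selects, among the active balls $B$ with $(x_t,y)\in \mathrm{dom}_t(B)$ for some $y$, one with maximal index $I_t(B)$, and plays an arm $y_t$ with $(x_t,y_t)\in\mathrm{dom}_t(B)$; ties and the choice of the arm are arbitrary (measurable). If $\mathrm{rad}_t(B)\le r(B)$, then the ball with center $(x_t,y_t)$ and radius $\tfrac12 r(B)$ is activated, and is active from round $t+1$ on. **Zooming numbers.** For $r>0$ let $N(r)\in\mathbb N\cup\{\infty\}$ be the smallest number of sets of diameter at most $r$ that cover $\{(x,y)\in\mathcal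 P:\ \mu^*(x)-\mu(x,y)\le 12r\}$. For $c>0$, the contextual zooming dimension with constant $c$ is the infimum $d$ of all $d'>0$ such that $N(r)\le c\,r^{-d'}$ for all $r\in(0,1]$, provided that such a $d'$ exists. **Theorem.** There are absolute constants $C_1,C_2$ such that for every such instance, every $T\ge2$ and every execution of the contextual zooming algorithm with time horizon $T$, putting $$\mathcal B(T)=\inf_{r_0>0}\Bigl(r_0T+\sum_{r=2^{-i},\ i\in\mathbb N,\ r_0\le r\le1}\tfrac1r\,N(r)\log T\Bigr),$$ one has $R(T)\le C_1\,\mathcal B(T)$ with probability at least $1-1/T$, and also $\mathbb E[R(T)]\le C_1\,\mathcal B(T)$. Moreover, for every $c>0$ for which the contextual zooming dimension $d$ with constant $c$ exists, $$C_1\,\mathcal B(T)\le C_2\;c\;T^{1-1/(2+d)}\log T .$$ -/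

import Mathlib

open MeasureTheory ProbabilityTheory
open scoped ENNReal NNReal

/-- The `r`-covering number of a set `S` in a metric space: the smallest number of sets of
diameter at most `r` that cover `S` (`⊤` if no finite family does). -/
noncomputable def diamCoveringNumber {E : Type*} [MetricSpace E] (r : ℝ) (S : Set E) : ℕ∞ :=
  ⨅ (n : ℕ) (_ : ∃ U : Fin n → Set E,
    (∀ i, ∀ p ∈ U i, ∀ q ∈ U i, dist p q ≤ r) ∧ S ⊆ ⋃ i, U i), (n : ℕ∞)

/-- An instance of the stochastic contextual bandit problem with context set `X`, arms set `Y`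
and set `P` of feasible context-arm pairs: a distribution `law` over payoff functions
`P → [0,1]` (the family of payoff functions being parametrized by a measurable space `Φ`), and a
sequence of context arrivals, fixed in advance. Rounds are numbered from `0`.
The σ-algebra on `P` is arbitrary; it is only used to make sense of random elements of `P`. -/
structure ContextualMAB {X Y : Type*} (P : Set (X × Y)) [MeasurableSpace P]
    (Φ : Type*) [MeasurableSpace Φ] where
  payoff : Φ → P → ℝ
  payoff_mem : ∀ φ p, payoff φ p ∈ Set.Icc (0 : ℝ) 1
  measurable_payoff : Measurable (Function.uncurry payoff)
  law : Measure Φ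
  law_prob : IsProbabilityMeasure law
  context : ℕ → X

namespace ContextualMAB

variable {X Y : Type*} {P : Set (X × Y)} [MeasurableSpace P] {Φ : Type*} [MeasurableSpace Φ]

/-- Expected payoff `μ(x,y)`. -/
noncomputable def mean (M : ContextualMAB P Φ) (p : P) : ℝ := ∫ φ, M.payoff φ p ∂M.law

/-- Benchmark payoff `μ*(x)`: the supremum of `μ(x,y)` over the arms `y` feasible for `x`. -/
noncomputable def bestMean (M : ContextualMAB P Φ) (x : X) : ℝ :=
  ⨆ p : {p : P // p.1.1 = x}, M.mean p.1

/-- Badness `Δ(x,y) = μ*(x) - μ(x,y)`. -/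
noncomputable def badness (M : ContextualMAB P Φ) (p : P) : ℝ := M.bestMean p.1.1 - M.mean p

variable [MetricSpace P]

/-- The expected payoffs are Lipschitz (with constant 1) on the similarity space. -/
def IsLipschitz (M : ContextualMAB P Φ) : Prop :=
  ∀ p q : P, |M.mean p - M.mean q| ≤ dist p q

/-- The `r`-zooming number `N(r)`. -/
noncomputable def zoomingNumber (M : ContextualMAB P Φ) (r : ℝ) : ℕ∞ :=
  diamCoveringNumber r {p : P | M.badness p ≤ 12 * r}

/-- `d` is the contextual zooming dimension with constant `c`: the infimum of the `d' > 0` such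
that `N(r) ≤ c r^{-d'}` for all `r ∈ (0,1]`. In particular some such `d'` exists, since the empty
set of reals has no greatest lower bound. -/
def IsZoomingDim (M : ContextualMAB P Φ) (c d : ℝ) : Prop :=
  IsGLB {d' : ℝ | 0 < d' ∧ ∀ r : ℝ, 0 < r → r ≤ 1 →
    (M.zoomingNumber r : ℝ≥0∞) ≤ ENNReal.ofReal (c * r ^ (-d'))} d

open Classical in
/-- `inf_{r₀ > 0} ( r₀ T + ∑_{r = 2^{-i}, r₀ ≤ r ≤ 1} N(r) log T / r )`. -/
noncomputable def zoomingBound (M : ContextualMAB P Φ) (T : ℕ) : ℝ≥0∞ :=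
  ⨅ (r₀ : ℝ) (_ : 0 < r₀), (ENNReal.ofReal (r₀ * T) +
    ∑' i : ℕ, if r₀ ≤ (1 / 2 : ℝ) ^ i then
      (M.zoomingNumber ((1 / 2 : ℝ) ^ i) : ℝ≥0∞) *
        ENNReal.ofReal (Real.log T / (1 / 2 : ℝ) ^ i)
    else 0)

end ContextualMAB

/-- What happens in one execution of the algorithm. At most one ball is activated per round, so
balls are named by natural numbers: ball `0` is the initial ball, and ball `s + 1` is the one that
is activated in round `s` (if any). `sel t` is the ball selected in round `t`, `pt t` is the
context-arm pair `(x_t, y_t)`, and `pay t` is the payoff received in round `t`. -/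
structure ZoomingTranscript (E : Type*) where
  start : E
  sel : ℕ → ℕ
  pt : ℕ → E
  pay : ℕ → ℝ

namespace ZoomingTranscript

variable {E : Type*} (h : ZoomingTranscript E)

/-- Centers of the balls. -/
def center : ℕ → E
  | 0 => h.start
  | s + 1 => h.pt s

/-- Radii of the balls: the initial ball has radius `1`, and a ball activated in round `s` has
half the radius of its parent, the ball selected in round `s` (only a ball with name at most `s`
can be active in round `s`, so that the minimum is just `h.sel s`). -/
noncomputable def radius : ℕ → ℝ
  | 0 => 1
  | s + 1 => radius (min (h.sel s) s) / 2
  termination_by j => j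

/-- `n_t(B)`: the number of rounds before `t` in which ball `j` was selected. -/
def count (t j : ℕ) : ℕ := ((Finset.range t).filter fun s => h.sel s = j).card

/-- `ν_t(B)`: the average payoff in those rounds (`0` if there are none). -/
noncomputable def avg (t j : ℕ) : ℝ :=
  (∑ s ∈ (Finset.range t).filter fun s => h.sel s = j, h.pay s) / h.count t j

/-- The confidence radius. -/
noncomputable def conf (T t j : ℕ) : ℝ := 4 * Real.sqrt (Real.log T / (1 + h.count t j))

/-- Ball `j` is active in round `t`: it is the initial ball, or it was activated, according to the
activation rule, in a round `s < t`. -/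
def Active (T t j : ℕ) : Prop :=
  j = 0 ∨ ∃ s < t, j = s + 1 ∧ h.conf T s (h.sel s) ≤ h.radius (h.sel s)

/-- The pre-index. -/
noncomputable def preIndex (T t j : ℕ) : ℝ := h.avg t j + 2 * h.radius j + h.conf T t j

variable [MetricSpace E]

/-- The index: a minimum over the finitely many active balls of at least the same radius. -/
noncomputable def index (T t j : ℕ) : ℝ :=
  sInf ((fun k => h.preIndex T t k + dist (h.center j) (h.center k)) ''
    {k | h.Active T t k ∧ h.radius j ≤ h.radius k})

/-- The domain of a ball: the ball minus all active balls of strictly smaller radius. -/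
def domain (T t j : ℕ) : Set E :=
  Metric.closedBall (h.center j) (h.radius j) \
    ⋃ k ∈ {k | h.Active T t k ∧ h.radius k < h.radius j},
      Metric.closedBall (h.center k) (h.radius k)

end ZoomingTranscript

/-- Ball `j` is relevant in round `t`, in which context `x` arrives. -/
def ZoomingTranscript.Relevant {X Y : Type*} {P : Set (X × Y)} [MetricSpace P]
    (h : ZoomingTranscript P) (T t : ℕ) (x : X) (j : ℕ) : Prop :=
  h.Active T t j ∧ ∃ p ∈ h.domain T t j, p.1.1 = x

/-- The transcript obeys the contextual zooming algorithm with time horizon `T`, on the context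
arrivals `x`: the initial ball contains everything, and in each round the algorithm selects a
relevant ball of maximal index and plays some arm `y` with `(x_t, y)` in the domain of that ball.
Ties between balls, and the choice of the arm, are arbitrary. -/
def ZoomingTranscript.Obeys {X Y : Type*} {P : Set (X × Y)} [MetricSpace P]
    (h : ZoomingTranscript P) (T : ℕ) (x : ℕ → X) : Prop :=
  (∀ p : P, p ∈ Metric.closedBall h.start 1) ∧
  ∀ t < T,
    h.Relevant T t (x t) (h.sel t) ∧
    (∀ j, h.Relevant T t (x t) j → h.index T t j ≤ h.index T t (h.sel t)) ∧
    h.pt t ∈ h.domain T t (h.sel t) ∧ (h.pt t).1.1 = x t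

/-- A (random) execution of the contextual zooming algorithm with time horizon `T` on the instance
`M`, on a probability space `(Ω, pr)`. Here `past t` is the information available before the arm of
round `t` is chosen. The payoff function of round `t` is drawn from `M.law` independently of
`past t`, and belongs to `past (t + 1)`; in particular the payoff functions are i.i.d. The choices
made in round `t` only depend on `past t` (they may be randomized). -/
structure ZoomingExecution {X Y : Type*} {P : Set (X × Y)} [MeasurableSpace P] [MetricSpace P]
    {Φ : Type*} [MeasurableSpace Φ] (M : ContextualMAB P Φ) (T : ℕ)
    {Ω : Type*} [mΩ : MeasurableSpace Ω] (pr : Measure Ω) where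
  past : Filtration ℕ mΩ
  sample : ℕ → Ω → Φ
  measurable_sample : ∀ t, Measurable[past (t + 1)] (sample t)
  sample_law : ∀ t, pr.map (sample t) = M.law
  sample_indep : ∀ t, Indep (MeasurableSpace.comap (sample t) inferInstance) (past t) pr
  start : P
  sel : ℕ → Ω → ℕ
  pt : ℕ → Ω → P
  measurable_sel : ∀ t < T, Measurable[past t] (sel t)
  measurable_pt : ∀ t < T, Measurable[past t] (pt t)
  obeys : ∀ᵐ ω ∂pr, ZoomingTranscript.Obeys
    { start := start
      sel := fun t => sel t ω
      pt := fun t => pt t ω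
      pay := fun t => M.payoff (sample t ω) (pt t ω) } T M.context

/-- The contextual regret `R(T) = ∑_t (μ*(x_t) - μ(x_t, y_t))`. -/
noncomputable def ZoomingExecution.regret {X Y : Type*} {P : Set (X × Y)} [MeasurableSpace P]
    [MetricSpace P] {Φ : Type*} [MeasurableSpace Φ] {M : ContextualMAB P Φ} {T : ℕ}
    {Ω : Type*} [MeasurableSpace Ω] {pr : Measure Ω} (A : ZoomingExecution M T pr) (ω : Ω) : ℝ :=
  ∑ t ∈ Finset.range T, (M.bestMean (M.context t) - M.mean (A.pt t ω))

/-! The proof separates one random event from a deterministic argument. On the event `AvgAccurate`,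
the average payoff of each active ball is always within its radius plus its confidence radius of the
mean at its center.

On this event, the Lipschitz condition makes indices optimistic, so the index of the selected ball
is at least the benchmark. The same index exceeds the mean at the played pair by at most a multiple
of the radius `r`. This is read off from the ball itself once its confidence radius has dropped to
`r`, and from its parent before that. A round thus costs O(r). A ball is charged O(log T / r²)
rounds, because a selected ball whose confidence radius has dropped to `r` passes the charge on to
its new child (`card_charge_le`). Centers of balls of radius `r` are more than `r` apart and have
badness at most `12 r`, so there are at most N(r) such balls. Multiplying these and summing over the
scales above `r₀`, with a cost of at most `15 r₀` per round for smaller balls, gives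
`sum_badness_le`.

The event fails with probability at most 1/T: Hoeffding's lemma yields an exponential
supermartingale for each ball, and Markov's inequality and a union bound finish
(`measure_badEvent_le`). In expectation the failure costs at most T · (1/T) = 1, which the bound
absorbs because it is at least 1/2. The dimension bound comes from balancing the two terms at `r₀ =
T^(-1/(2+d))`. -/

/-- A set containing a family of points at pairwise distance more than `r` has `r`-covering number
at least the size of the family. -/
theorem card_le_diamCoveringNumber {E ι : Type*} [MetricSpace E] {r : ℝ} {S : Set E}
    (F : Finset ι) (f : ι → E) (hS : ∀ j ∈ F, f j ∈ S)
    (hsep : ∀ j ∈ F, ∀ k ∈ F, j ≠ k → r < dist (f j) (f k)) :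
    (F.card : ℕ∞) ≤ diamCoveringNumber r S := by
  refine le_iInf₂ fun n hn => ?_
  obtain ⟨U, hU, hcov⟩ := hn
  have hex : ∀ j : F, ∃ i, f j ∈ U i := fun j => Set.mem_iUnion.1 (hcov (hS j j.2))
  choose g hg using hex
  have hinj : Function.Injective g := by
    intro j k hjk
    by_contra hne
    have h1 := hsep j j.2 k k.2 (fun h => hne (Subtype.ext h))
    have h2 := hU (g j) _ (hg j) _ (hjk ▸ hg k)
    linarith
  have := Fintype.card_le_of_injective g hinj
  simp only [Fintype.card_coe, Fintype.card_fin] at this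
  exact_mod_cast this

/-! ### Range and measurability of the mean payoffs. -/

namespace ContextualMAB

variable {X Y : Type*} {P : Set (X × Y)} [MeasurableSpace P] {Φ : Type*} [MeasurableSpace Φ]

theorem measurable_payoff_right (M : ContextualMAB P Φ) (p : P) :
    Measurable fun φ => M.payoff φ p :=
  M.measurable_payoff.comp measurable_prodMk_right

theorem mean_nonneg (M : ContextualMAB P Φ) (p : P) : 0 ≤ M.mean p :=
  integral_nonneg fun φ => (M.payoff_mem φ p).1

theorem mean_le_one (M : ContextualMAB P Φ) (p : P) : M.mean p ≤ 1 := by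
  have := M.law_prob
  calc M.mean p ≤ ∫ _, (1 : ℝ) ∂M.law :=
        integral_mono_of_nonneg (ae_of_all _ fun φ => (M.payoff_mem φ p).1)
          (integrable_const _) (ae_of_all _ fun φ => (M.payoff_mem φ p).2)
    _ = 1 := by simp

theorem measurable_mean (M : ContextualMAB P Φ) : Measurable M.mean := by
  have := M.law_prob
  exact (M.measurable_payoff.stronglyMeasurable.integral_prod_left' (μ := M.law)).measurable

theorem bestMean_nonneg (M : ContextualMAB P Φ) (x : X) : 0 ≤ M.bestMean x :=
  Real.iSup_nonneg fun p => M.mean_nonneg p.1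

theorem bestMean_le_one (M : ContextualMAB P Φ) (x : X) : M.bestMean x ≤ 1 :=
  Real.iSup_le (fun p => M.mean_le_one p.1) zero_le_one

theorem badness_le_one (M : ContextualMAB P Φ) (p : P) : M.badness p ≤ 1 := by
  have := M.bestMean_le_one p.1.1
  have := M.mean_nonneg p
  unfold badness
  linarith

theorem one_le_zoomingNumber_one [MetricSpace P] (M : ContextualMAB P Φ) (p : P) :
    1 ≤ M.zoomingNumber 1 := by
  have := card_le_diamCoveringNumber (r := 1) (S := {p : P | M.badness p ≤ 12 * 1})
    ({()} : Finset Unit) (fun _ => p)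
    (fun _ _ => (M.badness_le_one p).trans (by norm_num)) (fun _ _ _ _ h => (h rfl).elim)
  simpa [zoomingNumber] using this

end ContextualMAB

/-! ### Combinatorics of transcripts: radii, charging, indices, domains. -/

namespace ZoomingTranscript

section Basic

variable {E : Type*} (h : ZoomingTranscript E)

theorem count_mono {s t : ℕ} (hst : s ≤ t) (j : ℕ) : h.count s j ≤ h.count t j :=
  Finset.card_le_card (Finset.filter_subset_filter _ (Finset.range_mono hst))

theorem conf_anti {T s t : ℕ} (hT : 1 ≤ T) (hst : s ≤ t) (j : ℕ) :
    h.conf T t j ≤ h.conf T s j := by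
  have h1 : (h.count s j : ℝ) ≤ h.count t j := by exact_mod_cast h.count_mono hst j
  have h2 : 0 ≤ Real.log T := Real.log_nonneg (by exact_mod_cast hT)
  unfold conf
  gcongr

theorem conf_nonneg (T t j : ℕ) : 0 ≤ h.conf T t j := by
  unfold conf
  positivity

theorem preIndex_le {T t j : ℕ} {a : ℝ} (ha : |h.avg t j - a| ≤ h.radius j + h.conf T t j) :
    h.preIndex T t j ≤ a + 3 * h.radius j + 2 * h.conf T t j := by
  have h1 := (abs_le.1 ha).2
  unfold preIndex
  linarith

/-- A child has half the radius and a strictly larger name than its parent. The bound `i ≤ j` later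
confines the scales of the active balls to a finite range. -/
theorem exists_radius_eq (j : ℕ) : ∃ i ≤ j, h.radius j = (1 / 2 : ℝ) ^ i := by
  induction j using Nat.strong_induction_on with
  | _ j ih =>
    rcases j with _ | s
    · exact ⟨0, le_rfl, by simp [radius]⟩
    · obtain ⟨i, hi, hr⟩ := ih (min (h.sel s) s) (by omega)
      exact ⟨i + 1, by omega, by rw [radius, hr]; ring⟩

theorem radius_pos (j : ℕ) : 0 < h.radius j := by
  obtain ⟨i, -, hi⟩ := h.exists_radius_eq j
  rw [hi]
  positivity

theorem radius_le_one (j : ℕ) : h.radius j ≤ 1 := by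
  obtain ⟨i, -, hi⟩ := h.exists_radius_eq j
  rw [hi]
  exact pow_le_one₀ (by norm_num) (by norm_num)

theorem radius_succ {s : ℕ} (hs : h.sel s ≤ s) : h.radius (s + 1) = h.radius (h.sel s) / 2 := by
  rw [radius, min_eq_left hs]

open Classical in
/-- The ball that the regret of round `t` is charged to: the ball activated in round `t` if there
is one, and the selected ball otherwise. -/
noncomputable def charge (T t : ℕ) : ℕ :=
  if h.conf T t (h.sel t) ≤ h.radius (h.sel t) then t + 1 else h.sel t

/-- Apart from the round that activates it, a ball is charged only when it is selected while its
confidence radius still exceeds its radius. This bounds its count, as the confidence radius shrinks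
like the inverse square root of the count. -/
theorem card_charge_le {T : ℕ} (hT : 2 ≤ T) (j : ℕ) :
    (((Finset.range T).filter fun t => h.charge T t = j).card : ℝ) ≤
      18 * Real.log T / h.radius j ^ 2 := by
  classical
  have hr := h.radius_pos j
  have hr1 := h.radius_le_one j
  have hlog2 : Real.log 2 ≤ Real.log T := Real.log_le_log (by norm_num) (by exact_mod_cast hT)
  have hlog : 1 / 2 ≤ Real.log T := by linarith [Real.log_two_gt_d9]
  set S := (Finset.range T).filter fun t => h.sel t = j ∧ h.radius j < h.conf T t j with hS
  -- Only round `j - 1` can activate ball `j`. For `j = 0` the truncated subtraction inserts a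
  -- spurious round, which only weakens the bound.
  have hsub : ((Finset.range T).filter fun t => h.charge T t = j) ⊆ insert (j - 1) S := by
    intro t ht
    obtain ⟨ht, hc⟩ := Finset.mem_filter.1 ht
    unfold charge at hc
    split_ifs at hc with hact
    · exact Finset.mem_insert.2 (Or.inl (by omega))
    · refine Finset.mem_insert_of_mem (Finset.mem_filter.2 ⟨ht, hc, ?_⟩)
      rw [hc] at hact
      exact not_le.1 hact
  have hcard : (((Finset.range T).filter fun t => h.charge T t = j).card : ℝ) ≤ S.card + 1 := by
    exact_mod_cast (Finset.card_le_card hsub).trans (Finset.card_insert_le _ _)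
  have hScard : (S.card : ℝ) ≤ 16 * Real.log T / h.radius j ^ 2 := by
    rcases S.eq_empty_or_nonempty with h0 | hne
    · rw [h0]
      simp only [Finset.card_empty, Nat.cast_zero]
      positivity
    -- All other rounds of `S` precede `u` and are counted by `count u j`, so testing the confidence
    -- radius at `u` bounds the whole of `S`.
    set u := S.max' hne with hu
    have huS : u ∈ S := S.max'_mem hne
    have hcount : S.card ≤ h.count u j + 1 := by
      have : S.erase u ⊆ (Finset.range u).filter fun s => h.sel s = j := by
        intro s hs
        obtain ⟨hne', hs⟩ := Finset.mem_erase.1 hs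
        have := S.le_max' s hs
        exact Finset.mem_filter.2 ⟨Finset.mem_range.2 (by omega), (Finset.mem_filter.1 hs).2.1⟩
      have := Finset.card_le_card this
      rw [Finset.card_erase_of_mem huS] at this
      unfold count
      omega
    have hlt := (Finset.mem_filter.1 huS).2.2
    unfold conf at hlt
    have hsq : h.radius j ^ 2 ≤ 16 * (Real.log T / (1 + h.count u j)) := by
      calc h.radius j ^ 2 ≤ (4 * √(Real.log T / (1 + h.count u j))) ^ 2 :=
            pow_le_pow_left₀ hr.le hlt.le 2
        _ = _ := by rw [mul_pow, Real.sq_sqrt (by positivity)]; norm_num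
    rw [le_div_iff₀ (by positivity)]
    have hc' : (S.card : ℝ) ≤ 1 + h.count u j := by
      have : (S.card : ℝ) ≤ ((h.count u j + 1 : ℕ) : ℝ) := by exact_mod_cast hcount
      push_cast at this
      linarith
    calc (S.card : ℝ) * h.radius j ^ 2
        ≤ (1 + h.count u j) * (16 * (Real.log T / (1 + h.count u j))) := by gcongr
      _ = 16 * Real.log T := by field_simp
  -- The activating round is absorbed using `log T ≥ 1/2`, which turns 16 into 18.
  have h1 : 1 ≤ 2 * Real.log T / h.radius j ^ 2 := by
    rw [le_div_iff₀ (by positivity)]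
    nlinarith
  calc _ ≤ (S.card : ℝ) + 1 := hcard
    _ ≤ 16 * Real.log T / h.radius j ^ 2 + 2 * Real.log T / h.radius j ^ 2 := by linarith
    _ = _ := by ring

variable {h}

theorem Active.mono {T s t j : ℕ} (hj : h.Active T s j) (hst : s ≤ t) : h.Active T t j :=
  hj.imp_right fun ⟨u, hu, hr⟩ => ⟨u, hu.trans_le hst, hr⟩

theorem Active.le {T t j : ℕ} (hj : h.Active T t j) : j ≤ t := by
  rcases hj with rfl | ⟨s, hs, rfl, -⟩ <;> omega

/-- An active ball with a small name was activated early. -/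
theorem Active.of_le {T t s j : ℕ} (hj : h.Active T t j) (hjs : j ≤ s) : h.Active T s j := by
  rcases hj with rfl | ⟨u, hu, rfl, hr⟩
  · exact Or.inl rfl
  · exact Or.inr ⟨u, hjs, rfl, hr⟩

theorem finite_active (T t : ℕ) : {j | h.Active T t j}.Finite :=
  (Set.finite_Iic t).subset fun _ hj => hj.le

variable [MetricSpace E]

theorem finite_index_set (T t j : ℕ) :
    ((fun k => h.preIndex T t k + dist (h.center j) (h.center k)) ''
      {k | h.Active T t k ∧ h.radius j ≤ h.radius k}).Finite :=
  ((finite_active T t).subset fun _ hk => hk.1).image _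

theorem index_le {T t j k : ℕ} (hk : h.Active T t k) (hr : h.radius j ≤ h.radius k) :
    h.index T t j ≤ h.preIndex T t k + dist (h.center j) (h.center k) :=
  csInf_le (finite_index_set T t j).bddBelow ⟨k, ⟨hk, hr⟩, rfl⟩

theorem le_index {T t j : ℕ} {a : ℝ} (hj : h.Active T t j)
    (ha : ∀ k, h.Active T t k → h.radius j ≤ h.radius k →
      a ≤ h.preIndex T t k + dist (h.center j) (h.center k)) :
    a ≤ h.index T t j := by
  refine le_csInf ⟨_, j, ⟨hj, le_rfl⟩, rfl⟩ ?_
  rintro _ ⟨k, ⟨hk, hr⟩, rfl⟩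
  exact ha k hk hr

/-- The domains of the active balls cover the space. -/
theorem exists_mem_domain (hstart : ∀ p : E, p ∈ Metric.closedBall h.start 1) (T t : ℕ) (p : E) :
    ∃ j, h.Active T t j ∧ p ∈ h.domain T t j := by
  have hfin : {j | h.Active T t j ∧ p ∈ Metric.closedBall (h.center j) (h.radius j)}.Finite :=
    (finite_active T t).subset fun _ hk => hk.1
  have h0 : 0 ∈ {j | h.Active T t j ∧ p ∈ Metric.closedBall (h.center j) (h.radius j)} :=
    ⟨Or.inl rfl, by simpa only [center, radius] using hstart p⟩
  -- Among the active balls containing `p`, one of least radius has `p` in its domain.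
  obtain ⟨j, hj, hmin⟩ := Set.exists_min_image _ h.radius hfin ⟨0, h0⟩
  refine ⟨j, hj.1, hj.2, ?_⟩
  simp only [Set.mem_iUnion, not_exists]
  intro k hk hpk
  exact absurd (hmin k ⟨hk.1, hpk⟩) (not_le.2 hk.2)

theorem mem_closedBall_of_mem_domain {T t j : ℕ} {p : E} (hp : p ∈ h.domain T t j) :
    dist p (h.center j) ≤ h.radius j := hp.1

end Basic

/-! ### Regret when all averages are accurate. -/

section Deterministic

variable {X Y : Type*} {P : Set (X × Y)} [MetricSpace P] {h : ZoomingTranscript P} {T : ℕ}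
  {x : ℕ → X}

theorem Obeys.sel_le (ho : h.Obeys T x) {t : ℕ} (ht : t < T) : h.sel t ≤ t :=
  (ho.2 t ht).1.1.le

theorem Obeys.dist_pt_le (ho : h.Obeys T x) {t : ℕ} (ht : t < T) :
    dist (h.pt t) (h.center (h.sel t)) ≤ h.radius (h.sel t) :=
  mem_closedBall_of_mem_domain (ho.2 t ht).2.2.1

/-- Two distinct active balls of the same radius have centers further apart than that radius. -/
theorem Obeys.radius_lt_dist_center (ho : h.Obeys T x) {j k : ℕ} (hj : h.Active T T j)
    (hk : h.Active T T k) (hr : h.radius j = h.radius k) (hjk : j ≠ k) :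
    h.radius j < dist (h.center j) (h.center k) := by
  wlog hlt : j < k generalizing j k
  · rw [dist_comm, hr]
    exact this hk hj hr.symm hjk.symm (by omega)
  rcases hk with rfl | ⟨s, hs, rfl, -⟩
  · omega
  have hj' : h.Active T s j := hj.of_le (by omega)
  have hrs := h.radius_succ (ho.sel_le hs)
  have hpos := h.radius_pos (s + 1)
  have hnot := (ho.2 s hs).2.2.1.2
  -- The later center was played in the domain of its parent, which has twice the common radius.
  -- That domain excludes the earlier, smaller ball.
  simp only [Set.mem_iUnion, not_exists] at hnot
  have := hnot j ⟨hj', by linarith⟩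
  rw [Metric.mem_closedBall, not_le, dist_comm] at this
  exact this

theorem Obeys.active_charge (ho : h.Obeys T x) {t : ℕ} (ht : t < T) :
    h.Active T T (h.charge T t) := by
  unfold charge
  split_ifs with hact
  · exact Or.inr ⟨t, ht, rfl, hact⟩
  · exact (ho.2 t ht).1.1.mono ht.le

variable [MeasurableSpace P] {Φ : Type*} [MeasurableSpace Φ] {M : ContextualMAB P Φ}

/-- The average payoff of every active ball is within the confidence radius, plus the radius of
the ball, of the expected payoff at the center. -/
def AvgAccurate (h : ZoomingTranscript P) (M : ContextualMAB P Φ) (T : ℕ) : Prop :=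
  ∀ t < T, ∀ j, h.Active T t j →
    |h.avg t j - M.mean (h.center j)| ≤ h.radius j + h.conf T t j

/-- Of the two radii in the pre-index of `k`, one pays for the bias of the average. The other pays
for moving from the center of `j` to `p`, as `radius j ≤ radius k`; the distance term pays for
moving between centers. -/
theorem AvgAccurate.mean_le_index (ha : h.AvgAccurate M T) (hM : M.IsLipschitz) {t j : ℕ}
    (ht : t < T) (hj : h.Active T t j) {p : P} (hp : dist p (h.center j) ≤ h.radius j) :
    M.mean p ≤ h.index T t j := by
  refine le_index hj fun k hk hr => ?_
  have h1 := (abs_le.1 (ha t ht k hk)).1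
  have h2 := (abs_le.1 (hM p (h.center j))).2
  have h3 := (abs_le.1 (hM (h.center j) (h.center k))).2
  unfold preIndex
  linarith

/-- The index of the selected ball is optimistic. -/
theorem AvgAccurate.bestMean_le_index (ha : h.AvgAccurate M T) (hM : M.IsLipschitz)
    (ho : h.Obeys T x) {t : ℕ} (ht : t < T) :
    M.bestMean (x t) ≤ h.index T t (h.sel t) := by
  obtain ⟨-, hmax, -, hpt⟩ := ho.2 t ht
  have : Nonempty {p : P // p.1.1 = x t} := ⟨⟨h.pt t, hpt⟩⟩
  refine ciSup_le fun p => ?_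
  obtain ⟨j, hj, hpj⟩ := exists_mem_domain ho.1 T t p.1
  exact (ha.mean_le_index hM ht hj (mem_closedBall_of_mem_domain hpj)).trans
    (hmax j ⟨hj, p.1, hpj, p.2⟩)

/-- A pair at which a new ball is activated has small badness. -/
theorem AvgAccurate.badness_le_of_activates (ha : h.AvgAccurate M T) (hM : M.IsLipschitz)
    (ho : h.Obeys T x) {t : ℕ} (ht : t < T) (hact : h.conf T t (h.sel t) ≤ h.radius (h.sel t)) :
    M.badness (h.pt t) ≤ 12 * h.radius (t + 1) := by
  have hsel := (ho.2 t ht).1.1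
  have h1 := ha.bestMean_le_index hM ho ht
  have h2 := index_le hsel le_rfl
  have h3 := h.preIndex_le (ha t ht _ hsel)
  have h4 := (abs_le.1 (hM (h.pt t) (h.center (h.sel t)))).1
  have h5 := ho.dist_pt_le ht
  rw [dist_self] at h2
  rw [ContextualMAB.badness, (ho.2 t ht).2.2.2, h.radius_succ (ho.sel_le ht)]
  linarith

/-- The ball may have been sampled too rarely for its own average to help, but its parent's
confidence radius was at most the parent's radius `2r` at activation and has not grown since. The
parent's pre-index, the distance of the centers and the Lipschitz step between them cost 7 · 2r;
moving to the played pair costs one more `r`. -/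
theorem AvgAccurate.badness_le_of_sel (ha : h.AvgAccurate M T) (hM : M.IsLipschitz)
    (ho : h.Obeys T x) {t : ℕ} (ht : t < T) :
    M.badness (h.pt t) ≤ 15 * h.radius (h.sel t) := by
  have hsel := (ho.2 t ht).1.1
  rcases hsel with h0 | ⟨s, hs, hj, hact⟩
  · have := M.badness_le_one (h.pt t)
    rw [h0, radius]
    linarith
  have hsT := hs.trans ht
  have hpar : h.Active T t (h.sel s) := (ho.2 s hsT).1.1.mono hs.le
  have hr := h.radius_succ (ho.sel_le hsT)
  have hpos := h.radius_pos (s + 1)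
  have h1 := ha.bestMean_le_index hM ho ht
  have h2 := index_le (j := h.sel t) hpar (by rw [hj]; linarith)
  have h3 := h.preIndex_le (ha t ht _ hpar)
  have h4 := (abs_le.1 (hM (h.pt t) (h.center (h.sel t)))).1
  have h5 := ho.dist_pt_le ht
  have h6 := (abs_le.1 (hM (h.center (h.sel t)) (h.center (h.sel s)))).1
  have h7 : dist (h.center (h.sel t)) (h.center (h.sel s)) ≤ h.radius (h.sel s) := by
    rw [hj]
    exact ho.dist_pt_le hsT
  have h8 := h.conf_anti (T := T) (by omega) hs.le (h.sel s)
  rw [← hj] at hr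
  rw [ContextualMAB.badness, (ho.2 t ht).2.2.2]
  linarith

theorem AvgAccurate.badness_center_le (ha : h.AvgAccurate M T) (hM : M.IsLipschitz)
    (ho : h.Obeys T x) {j : ℕ} (hj : h.Active T T j) :
    M.badness (h.center j) ≤ 12 * h.radius j := by
  rcases hj with rfl | ⟨s, hs, rfl, hact⟩
  · have := M.badness_le_one (h.center 0)
    rw [radius]
    linarith
  · exact ha.badness_le_of_activates hM ho hs hact

open Classical in
/-- The number of active balls of radius `r` is at most the `r`-zooming number. -/
theorem AvgAccurate.card_le_zoomingNumber (ha : h.AvgAccurate M T) (hM : M.IsLipschitz)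
    (ho : h.Obeys T x) (r : ℝ) :
    (((Finset.range (T + 1)).filter fun j => h.Active T T j ∧ h.radius j = r).card : ℕ∞) ≤
      M.zoomingNumber r := by
  refine card_le_diamCoveringNumber _ h.center (fun j hj => ?_) fun j hj k hk hjk => ?_
  · obtain ⟨-, hact, rfl⟩ := Finset.mem_filter.1 hj
    exact ha.badness_center_le hM ho hact
  · obtain ⟨-, hj, hjr⟩ := Finset.mem_filter.1 hj
    obtain ⟨-, hk, hkr⟩ := Finset.mem_filter.1 hk
    rw [← hjr]
    exact ho.radius_lt_dist_center hj hk (hjr.trans hkr.symm) hjk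

theorem AvgAccurate.badness_le_charge (ha : h.AvgAccurate M T) (hM : M.IsLipschitz)
    (ho : h.Obeys T x) {t : ℕ} (ht : t < T) :
    M.badness (h.pt t) ≤ 15 * h.radius (h.charge T t) := by
  unfold charge
  split_ifs with hact
  · have := ha.badness_le_of_activates hM ho ht hact
    have := h.radius_pos (t + 1)
    linarith
  · exact ha.badness_le_of_sel hM ho ht

open Classical in
/-- The regret bound of an execution in which all averages are accurate. -/
theorem AvgAccurate.sum_badness_le (ha : h.AvgAccurate M T) (hM : M.IsLipschitz)
    (ho : h.Obeys T x) (hT : 2 ≤ T) :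
    ENNReal.ofReal (∑ t ∈ Finset.range T, M.badness (h.pt t)) ≤ 270 * M.zoomingBound T := by
  have hlog : 0 ≤ Real.log T := Real.log_nonneg (by exact_mod_cast (by omega : 1 ≤ T))
  unfold ContextualMAB.zoomingBound
  simp only [ENNReal.mul_iInf_of_ne (by norm_num : (270 : ℝ≥0∞) ≠ 0) (by norm_num)]
  refine le_iInf₂ fun r₀ hr₀ => ?_
  -- Rounds charged to balls of radius below `r₀` are paid by `15 r₀` each; `g` keeps only the
  -- others. The final constant is 270 = 15 · 18.
  set g : ℝ → ℝ := fun ρ => if r₀ ≤ ρ then ρ else 0 with hg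
  set G := (Finset.range (T + 1)).filter fun j => h.Active T T j with hG
  have hpt : ∀ t ∈ Finset.range T, M.badness (h.pt t) ≤ 15 * r₀ + 15 * g (h.radius (h.charge T t)) := by
    intro t ht
    have := ha.badness_le_charge hM ho (Finset.mem_range.1 ht)
    simp only [hg]
    split_ifs <;> linarith
  have hmaps : ∀ t ∈ Finset.range T, h.charge T t ∈ G := fun t ht => by
    have := ho.active_charge (Finset.mem_range.1 ht)
    exact Finset.mem_filter.2 ⟨Finset.mem_range.2 (by have := this.le; omega), this⟩
  have hsum : ∑ t ∈ Finset.range T, g (h.radius (h.charge T t)) ≤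
      ∑ j ∈ G, if r₀ ≤ h.radius j then 18 * (Real.log T / h.radius j) else 0 := by
    rw [← Finset.sum_fiberwise_of_maps_to hmaps]
    refine Finset.sum_le_sum fun j _ => ?_
    have : ∑ t ∈ (Finset.range T).filter (fun t => h.charge T t = j),
        g (h.radius (h.charge T t)) =
        ((Finset.range T).filter fun t => h.charge T t = j).card * g (h.radius j) := by
      rw [← nsmul_eq_mul]
      exact Finset.sum_eq_card_nsmul fun t ht => by rw [(Finset.mem_filter.1 ht).2]
    rw [this]
    simp only [hg]
    split_ifs
    · have hr := h.radius_pos j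
      calc _ ≤ 18 * Real.log T / h.radius j ^ 2 * h.radius j := by
            gcongr
            exact h.card_charge_le hT j
        _ = _ := by field_simp
    · simp
  have hreal : ∑ t ∈ Finset.range T, M.badness (h.pt t) ≤
      270 * (r₀ * T) +
        270 * ∑ j ∈ G, if r₀ ≤ h.radius j then Real.log T / h.radius j else 0 := by
    have h1 := Finset.sum_le_sum hpt
    rw [Finset.sum_add_distrib] at h1
    simp only [← Finset.mul_sum, Finset.sum_const, Finset.card_range, nsmul_eq_mul] at h1
    have h2 : ∑ j ∈ G, (if r₀ ≤ h.radius j then 18 * (Real.log T / h.radius j) else 0) =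
        18 * ∑ j ∈ G, if r₀ ≤ h.radius j then Real.log T / h.radius j else 0 := by
      rw [Finset.mul_sum]
      exact Finset.sum_congr rfl fun j _ => by split_ifs <;> simp
    have h3 : 0 ≤ r₀ * T := by positivity
    rw [h2] at hsum
    linarith
  choose i hi hri using h.exists_radius_eq
  have hmapsi : ∀ j ∈ G, i j ∈ Finset.range (T + 1) := fun j hj => by
    have := hi j
    have := (Finset.mem_filter.1 hj).2.le
    exact Finset.mem_range.2 (by omega)
  have hterm : ∀ ρ : ℝ, 0 < ρ → 0 ≤ if r₀ ≤ ρ then Real.log T / ρ else 0 := fun ρ hρ => by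
    split_ifs
    · positivity
    · exact le_rfl
  have hG_le : ENNReal.ofReal (∑ j ∈ G, if r₀ ≤ h.radius j then Real.log T / h.radius j else 0) ≤
      ∑' i : ℕ, if r₀ ≤ (1 / 2 : ℝ) ^ i then
        (M.zoomingNumber ((1 / 2 : ℝ) ^ i) : ℝ≥0∞) *
          ENNReal.ofReal (Real.log T / (1 / 2 : ℝ) ^ i)
      else 0 := by
    rw [ENNReal.ofReal_sum_of_nonneg fun j _ => hterm _ (h.radius_pos j),
      ← Finset.sum_fiberwise_of_maps_to hmapsi]
    refine le_trans (Finset.sum_le_sum fun k _ => ?_) (ENNReal.sum_le_tsum (Finset.range (T + 1)))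
    have hconst : ∑ j ∈ G.filter (fun j => i j = k),
        ENNReal.ofReal (if r₀ ≤ h.radius j then Real.log T / h.radius j else 0) =
        ((G.filter fun j => i j = k).card : ℝ≥0∞) *
          ENNReal.ofReal (if r₀ ≤ (1 / 2 : ℝ) ^ k then Real.log T / (1 / 2 : ℝ) ^ k else 0) := by
      rw [← nsmul_eq_mul]
      exact Finset.sum_eq_card_nsmul fun j hj => by rw [hri j, (Finset.mem_filter.1 hj).2]
    rw [hconst]
    split_ifs
    · gcongr
      have hsub : (G.filter fun j => i j = k) ⊆ (Finset.range (T + 1)).filter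
          fun j => h.Active T T j ∧ h.radius j = (1 / 2 : ℝ) ^ k := by
        intro j hj
        obtain ⟨hj, hik⟩ := Finset.mem_filter.1 hj
        obtain ⟨hj, hact⟩ := Finset.mem_filter.1 hj
        exact Finset.mem_filter.2 ⟨hj, hact, by rw [hri j, hik]⟩
      have h1 : ((G.filter fun j => i j = k).card : ℕ∞) ≤ M.zoomingNumber ((1 / 2 : ℝ) ^ k) :=
        le_trans (by exact_mod_cast Finset.card_le_card hsub)
          (ha.card_le_zoomingNumber hM ho ((1 / 2 : ℝ) ^ k))
      have h2 := ENat.toENNReal_le.2 h1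
      simpa using h2
    · simp
  calc ENNReal.ofReal (∑ t ∈ Finset.range T, M.badness (h.pt t))
      ≤ ENNReal.ofReal (270 * (r₀ * T) +
        270 * ∑ j ∈ G, if r₀ ≤ h.radius j then Real.log T / h.radius j else 0) :=
        ENNReal.ofReal_le_ofReal hreal
    _ = 270 * (ENNReal.ofReal (r₀ * T) + ENNReal.ofReal
        (∑ j ∈ G, if r₀ ≤ h.radius j then Real.log T / h.radius j else 0)) := by
        have hnn := Finset.sum_nonneg fun j (_ : j ∈ G) => hterm _ (h.radius_pos j)
        have hr₀T : 0 ≤ r₀ * T := mul_nonneg hr₀.le (Nat.cast_nonneg T)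
        rw [ENNReal.ofReal_add (by linarith) (by linarith),
          ENNReal.ofReal_mul (p := 270) (by norm_num),
          ENNReal.ofReal_mul (p := 270) (by norm_num), mul_add]
        norm_num
    _ ≤ _ := by gcongr

end Deterministic

end ZoomingTranscript

/-! ### Concentration of the average payoffs. -/

/-- Hoeffding's lemma for the payoff of a fixed pair. -/
theorem ContextualMAB.lintegral_exp_le {X Y : Type*} {P : Set (X × Y)} [MeasurableSpace P]
    {Φ : Type*} [MeasurableSpace Φ] (M : ContextualMAB P Φ) (l : ℝ) (p : P) :
    ∫⁻ φ, ENNReal.ofReal (Real.exp (l * (M.payoff φ p - M.mean p))) ∂M.law ≤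
      ENNReal.ofReal (Real.exp (l ^ 2 / 8)) := by
  have := M.law_prob
  have hsub := hasSubgaussianMGF_of_mem_Icc (μ := M.law) (X := fun φ => M.payoff φ p)
    (M.measurable_payoff_right p).aemeasurable (ae_of_all _ fun φ => M.payoff_mem φ p)
  have hle := hsub.mgf_le l
  unfold ContextualMAB.mean
  rw [← ofReal_integral_eq_lintegral_ofReal (hsub.integrable_exp_mul l)
    (ae_of_all _ fun _ => (Real.exp_pos _).le)]
  refine ENNReal.ofReal_le_ofReal (hle.trans_eq ?_)
  congr 1
  simp
  ring

/-- One step of the exponential supermartingale: a payoff function `X` which is independent of `g`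
is evaluated at a pair, provided that a ball is selected, both of which are functions of `g`. -/
theorem ContextualMAB.lintegral_mul_exp_le {X Y : Type*} {P : Set (X × Y)} [MeasurableSpace P]
    {Φ : Type*} [MeasurableSpace Φ] (M : ContextualMAB P Φ) {Ω Ω' : Type*} [MeasurableSpace Ω]
    [MeasurableSpace Ω'] {pr : Measure Ω} [IsProbabilityMeasure pr] {ξ : Ω → Φ} {g : Ω → Ω'}
    (hξ : Measurable ξ) (hg : Measurable g) (hind : IndepFun ξ g pr) (hlaw : pr.map ξ = M.law)
    {W : Ω' → ℝ≥0∞} (hW : Measurable W) {sel : Ω' → ℕ} (hsel : Measurable sel) {pt : Ω' → P}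
    (hpt : Measurable pt) (l : ℝ) (j : ℕ) :
    ∫⁻ ω, W (g ω) * ENNReal.ofReal (Real.exp (if sel (g ω) = j then
      l * (M.payoff (ξ ω) (pt (g ω)) - M.mean (pt (g ω))) - l ^ 2 / 8 else 0)) ∂pr ≤
      ∫⁻ ω, W (g ω) ∂pr := by
  have := M.law_prob
  have : IsProbabilityMeasure (pr.map g) := Measure.isProbabilityMeasure_map hg.aemeasurable
  have hmap := (indepFun_iff_map_prod_eq_prod_map_map hξ.aemeasurable hg.aemeasurable).1 hind
  set f : Φ × Ω' → ℝ≥0∞ := fun z => W z.2 * ENNReal.ofReal (Real.exp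
    (if sel z.2 = j then l * (M.payoff z.1 (pt z.2) - M.mean (pt z.2)) - l ^ 2 / 8 else 0)) with hf
  have hfm : Measurable f := by
    have hpt2 : Measurable fun z : Φ × Ω' => pt z.2 := hpt.comp measurable_snd
    refine (hW.comp measurable_snd).mul (ENNReal.measurable_ofReal.comp
      (Real.measurable_exp.comp (Measurable.ite ?_ ?_ measurable_const)))
    · exact (hsel.comp measurable_snd) (measurableSet_singleton j)
    · exact (((M.measurable_payoff.comp (measurable_fst.prodMk hpt2)).sub
        (M.measurable_mean.comp hpt2)).const_mul l).sub_const _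
  calc _ = ∫⁻ ω, f (ξ ω, g ω) ∂pr := rfl
    _ = ∫⁻ z, f z ∂(pr.map fun ω => (ξ ω, g ω)) := (lintegral_map hfm (hξ.prodMk hg)).symm
    -- By independence the joint law is a product. The past can be frozen and Hoeffding's lemma
    -- applied to the fresh payoff function at a fixed pair.
    _ = ∫⁻ ω', ∫⁻ φ, f (φ, ω') ∂M.law ∂(pr.map g) := by
        rw [hmap, hlaw, lintegral_prod_symm' f hfm]
    _ ≤ ∫⁻ ω', W ω' ∂(pr.map g) := lintegral_mono fun ω' => ?_
    _ = ∫⁻ ω, W (g ω) ∂pr := lintegral_map hW hg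
  simp only [hf]
  split_ifs with hj
  · have hm : Measurable fun φ => ENNReal.ofReal
        (Real.exp (l * (M.payoff φ (pt ω') - M.mean (pt ω')))) :=
      ENNReal.measurable_ofReal.comp (Real.measurable_exp.comp
        (((M.measurable_payoff_right _).sub_const _).const_mul l))
    have heq : ∀ φ, W ω' * ENNReal.ofReal (Real.exp
        (l * (M.payoff φ (pt ω') - M.mean (pt ω')) - l ^ 2 / 8)) =
        W ω' * ENNReal.ofReal (Real.exp (-(l ^ 2 / 8))) * ENNReal.ofReal
        (Real.exp (l * (M.payoff φ (pt ω') - M.mean (pt ω')))) := by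
      intro φ
      rw [mul_assoc, ← ENNReal.ofReal_mul (Real.exp_pos _).le, ← Real.exp_add]
      ring_nf
    simp only [heq]
    rw [lintegral_const_mul _ hm]
    calc _ ≤ W ω' * ENNReal.ofReal (Real.exp (-(l ^ 2 / 8))) *
          ENNReal.ofReal (Real.exp (l ^ 2 / 8)) := by
          gcongr
          exact M.lintegral_exp_le l _
      _ = W ω' := by
          rw [mul_assoc, ← ENNReal.ofReal_mul (Real.exp_pos _).le, ← Real.exp_add]
          simp
  · simp

namespace ZoomingExecution

variable {X Y : Type*} {P : Set (X × Y)} [MeasurableSpace P] [MetricSpace P]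
  {Φ : Type*} [MeasurableSpace Φ] {M : ContextualMAB P Φ} {T : ℕ}
  {Ω : Type*} [mΩ : MeasurableSpace Ω] {pr : Measure Ω} (A : ZoomingExecution M T pr)

/-- The transcript of a random execution. -/
def transcript (ω : Ω) : ZoomingTranscript P where
  start := A.start
  sel := fun t => A.sel t ω
  pt := fun t => A.pt t ω
  pay := fun t => M.payoff (A.sample t ω) (A.pt t ω)

/-- The sum of the deviations of the payoffs of ball `j` from their conditional means. -/
noncomputable def dev (j t : ℕ) (ω : Ω) : ℝ :=
  ∑ s ∈ (Finset.range t).filter fun s => A.sel s ω = j,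
    (M.payoff (A.sample s ω) (A.pt s ω) - M.mean (A.pt s ω))

theorem dev_succ (j t : ℕ) (ω : Ω) : A.dev j (t + 1) ω = A.dev j t ω +
    if A.sel t ω = j then M.payoff (A.sample t ω) (A.pt t ω) - M.mean (A.pt t ω) else 0 := by
  simp only [dev, Finset.sum_filter, Finset.sum_range_succ]

theorem count_succ (j t : ℕ) (ω : Ω) : ((A.transcript ω).count (t + 1) j : ℝ) =
    (A.transcript ω).count t j + if A.sel t ω = j then 1 else 0 := by
  rw [ZoomingTranscript.count, ZoomingTranscript.count, Finset.card_filter, Finset.card_filter,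
    Finset.sum_range_succ]
  push_cast
  rfl

theorem measurable_dev (j t : ℕ) (ht : t ≤ T) : Measurable[A.past t] (A.dev j t) := by
  unfold dev
  simp only [Finset.sum_filter]
  refine Finset.measurable_fun_sum _ fun s hs => ?_
  have hst := Finset.mem_range.1 hs
  have h1 : Measurable[A.past t] (A.sel s) :=
    (A.measurable_sel s (by omega)).mono (A.past.mono hst.le) le_rfl
  have h2 : Measurable[A.past t] (A.pt s) :=
    (A.measurable_pt s (by omega)).mono (A.past.mono hst.le) le_rfl
  have h3 : Measurable[A.past t] (A.sample s) :=
    (A.measurable_sample s).mono (A.past.mono hst) le_rfl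
  refine Measurable.ite (h1 (measurableSet_singleton j)) ?_ measurable_const
  exact (M.measurable_payoff.comp (h3.prodMk h2)).sub (M.measurable_mean.comp h2)

theorem measurable_count (j t : ℕ) (ht : t ≤ T) :
    Measurable[A.past t] fun ω => ((A.transcript ω).count t j : ℝ) := by
  have heq : (fun ω => ((A.transcript ω).count t j : ℝ)) =
      fun ω => ∑ s ∈ Finset.range t, if A.sel s ω = j then (1 : ℝ) else 0 := by
    funext ω
    rw [ZoomingTranscript.count, Finset.card_filter]
    push_cast
    rfl
  rw [heq]
  refine Finset.measurable_fun_sum _ fun s hs => ?_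
  have hst := Finset.mem_range.1 hs
  have h1 : Measurable[A.past t] (A.sel s) :=
    (A.measurable_sel s (by omega)).mono (A.past.mono hst.le) le_rfl
  exact Measurable.ite (h1 (measurableSet_singleton j)) measurable_const measurable_const

/-- The exponential supermartingale of the deviations of ball `j`. -/
theorem lintegral_exp_dev_le [IsProbabilityMeasure pr] (l : ℝ) (j t : ℕ) (ht : t ≤ T) :
    ∫⁻ ω, ENNReal.ofReal (Real.exp (l * A.dev j t ω -
      l ^ 2 / 8 * (A.transcript ω).count t j)) ∂pr ≤ 1 := by
  induction t with
  | zero => simp [dev, ZoomingTranscript.count]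
  | succ t ih =>
    have htT : t < T := ht
    have hsel := A.measurable_sel t htT
    have hpt := A.measurable_pt t htT
    set W : Ω → ℝ≥0∞ := fun ω => ENNReal.ofReal (Real.exp (l * A.dev j t ω -
      l ^ 2 / 8 * (A.transcript ω).count t j)) with hW
    have hWm : Measurable[A.past t] W := by
      have h1 := A.measurable_dev j t htT.le
      have h2 := A.measurable_count j t htT.le
      exact ENNReal.measurable_ofReal.comp (Real.measurable_exp.comp
        ((h1.const_mul l).sub (h2.const_mul _)))
    have hX : Measurable (A.sample t) := (A.measurable_sample t).mono (A.past.le _) le_rfl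
    -- The past enters as the identity map into `Ω` with the σ-algebra `past t`.
    have hid : @Measurable Ω Ω mΩ (A.past t) id := measurable_id'' (A.past.le t)
    have hindep : @IndepFun Ω Φ Ω mΩ _ (A.past t) (A.sample t) id pr := by
      have := A.sample_indep t
      rwa [← MeasurableSpace.comap_id (m := A.past t)] at this
    refine le_trans (le_of_eq (lintegral_congr fun ω => ?_))
      ((@ContextualMAB.lintegral_mul_exp_le X Y P _ Φ _ M Ω Ω mΩ (A.past t) pr _ (A.sample t) id
        hX hid hindep (A.sample_law t) W hWm (A.sel t) hsel (A.pt t) hpt l j).trans (ih htT.le))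
    simp only [hW, id]
    rw [← ENNReal.ofReal_mul (Real.exp_pos _).le, ← Real.exp_add, dev_succ, count_succ]
    congr 2
    split_ifs <;> ring

/-- Deviations of the payoffs of a ball that has been selected `n` times. -/
theorem measure_dev_ge_le [IsProbabilityMeasure pr] (hT : 2 ≤ T) {ε : ℝ} (hε : ε ^ 2 = 1)
    {j t n : ℕ} (ht : t ≤ T) (hn : 1 ≤ n) :
    pr {ω | (A.transcript ω).count t j = n ∧
      n * (A.transcript ω).conf T t j ≤ ε * A.dev j t ω} ≤ ENNReal.ofReal ((T : ℝ) ^ (-16 : ℝ)) := by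
  have hT0 : (0 : ℝ) < T := by exact_mod_cast (by omega : 0 < T)
  have hn1 : (1 : ℝ) ≤ n := by exact_mod_cast hn
  have hlog : 0 ≤ Real.log T := Real.log_nonneg (by exact_mod_cast (by omega : 1 ≤ T))
  set b : ℝ := 4 * √(Real.log T / (1 + n)) with hb
  have hb0 : 0 ≤ b := by positivity
  have hb2 : 8 * Real.log T ≤ n * b ^ 2 := by
    rw [hb, mul_pow, Real.sq_sqrt (by positivity)]
    have : n * (4 ^ 2 * (Real.log T / (1 + n))) = 16 * (n / (1 + n)) * Real.log T := by
      field_simp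
      ring
    rw [this]
    have : (1 / 2 : ℝ) ≤ n / (1 + n) := by
      rw [div_le_div_iff₀ (by norm_num) (by positivity)]
      linarith
    nlinarith
  -- This maximizes `l ε n b - l² n / 8`. The maximum `2 n b²` is at least `16 log T`, hence the
  -- exponent -16.
  set l : ℝ := 4 * b * ε with hl
  have hmarkov := mul_meas_ge_le_lintegral₀ (μ := pr) (f := fun ω =>
    ENNReal.ofReal (Real.exp (l * A.dev j t ω - l ^ 2 / 8 * (A.transcript ω).count t j)))
    (by
      have h1 := (A.measurable_dev j t ht).mono (A.past.le t) le_rfl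
      have h2 := (A.measurable_count j t ht).mono (A.past.le t) le_rfl
      exact (ENNReal.measurable_ofReal.comp (Real.measurable_exp.comp
        ((h1.const_mul l).sub (h2.const_mul _)))).aemeasurable)
    (ENNReal.ofReal ((T : ℝ) ^ (16 : ℝ)))
  have hle := hmarkov.trans (A.lintegral_exp_dev_le l j t ht)
  have hsub : {ω | (A.transcript ω).count t j = n ∧
      n * (A.transcript ω).conf T t j ≤ ε * A.dev j t ω} ⊆
      {ω | ENNReal.ofReal ((T : ℝ) ^ (16 : ℝ)) ≤ ENNReal.ofReal
        (Real.exp (l * A.dev j t ω - l ^ 2 / 8 * (A.transcript ω).count t j))} := by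
    rintro ω ⟨hcount, hdev⟩
    refine ENNReal.ofReal_le_ofReal ?_
    rw [Real.rpow_def_of_pos hT0, Real.exp_le_exp, hcount]
    rw [ZoomingTranscript.conf, hcount] at hdev
    have h1 : l * A.dev j t ω = 4 * b * (ε * A.dev j t ω) := by rw [hl]; ring
    have h2 : l ^ 2 / 8 = 2 * b ^ 2 := by rw [hl, mul_pow, hε]; ring
    rw [h1, h2]
    have h3 : 4 * b * (n * b) ≤ 4 * b * (ε * A.dev j t ω) := by gcongr
    nlinarith
  have hpos : ENNReal.ofReal ((T : ℝ) ^ (16 : ℝ)) ≠ 0 := by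
    rw [Ne, ENNReal.ofReal_eq_zero, not_le]
    positivity
  calc _ ≤ _ := measure_mono hsub
    _ ≤ (ENNReal.ofReal ((T : ℝ) ^ (16 : ℝ)))⁻¹ := by
        rw [ENNReal.le_inv_iff_mul_le, mul_comm]
        exact hle
    _ = _ := by
        rw [Real.rpow_neg hT0.le, ENNReal.ofReal_inv_of_pos (by positivity)]

/-- The event that some deviation exceeds the confidence radius. -/
def badEvent : Set Ω :=
  ⋃ t ∈ Finset.range T, ⋃ j ∈ Finset.range T, ⋃ n ∈ Finset.Icc 1 T, ⋃ ε ∈ ({1, -1} : Finset ℝ),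
    {ω | (A.transcript ω).count t j = n ∧ n * (A.transcript ω).conf T t j ≤ ε * A.dev j t ω}

/-- The count is random, so the union also runs over its values `n`, which makes each threshold
deterministic. There are `2 T³` events of probability at most `T^(-16)`. -/
theorem measure_badEvent_le [IsProbabilityMeasure pr] (hT : 2 ≤ T) :
    pr A.badEvent ≤ ENNReal.ofReal (1 / T) := by
  have hT0 : (0 : ℝ) < T := by exact_mod_cast (by omega : 0 < T)
  have hT2 : (2 : ℝ) ≤ T := by exact_mod_cast hT
  set q := ENNReal.ofReal ((T : ℝ) ^ (-16 : ℝ)) with hq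
  have h1 : pr A.badEvent ≤ ∑ t ∈ Finset.range T, ∑ j ∈ Finset.range T, ∑ n ∈ Finset.Icc 1 T,
      ∑ ε ∈ ({1, -1} : Finset ℝ), q := by
    unfold badEvent
    refine (measure_biUnion_finset_le _ _).trans (Finset.sum_le_sum fun t ht => ?_)
    refine (measure_biUnion_finset_le _ _).trans (Finset.sum_le_sum fun j _ => ?_)
    refine (measure_biUnion_finset_le _ _).trans (Finset.sum_le_sum fun n hn => ?_)
    refine (measure_biUnion_finset_le _ _).trans (Finset.sum_le_sum fun ε hε => ?_)
    refine A.measure_dev_ge_le hT ?_ (Finset.mem_range.1 ht).le (Finset.mem_Icc.1 hn).1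
    simp only [Finset.mem_insert, Finset.mem_singleton] at hε
    rcases hε with rfl | rfl <;> norm_num
  refine h1.trans ?_
  have h2 : ({1, -1} : Finset ℝ).card = 2 := Finset.card_pair (by norm_num)
  simp only [Finset.sum_const, Finset.card_range, Nat.card_Icc, h2, nsmul_eq_mul, hq]
  have h3 : ∀ k : ℕ, (k : ℝ≥0∞) = ENNReal.ofReal k := fun k => (ENNReal.ofReal_natCast k).symm
  rw [h3, h3, h3, ← ENNReal.ofReal_mul (by positivity), ← ENNReal.ofReal_mul (by positivity),
    ← ENNReal.ofReal_mul (by positivity), ← ENNReal.ofReal_mul (by positivity)]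
  refine ENNReal.ofReal_le_ofReal ?_
  have h4 : (T : ℝ) ^ (-16 : ℝ) = 1 / (T : ℝ) ^ 16 := by
    rw [Real.rpow_neg hT0.le, one_div]
    norm_cast
  rw [h4, Nat.add_sub_cancel]
  have h5 : (2 : ℝ) ≤ T ^ 12 := hT2.trans (le_self_pow₀ (by linarith) (by norm_num))
  have h6 : (T : ℝ) * (T * (T * ((2 : ℕ) * (1 / T ^ 16)))) = 2 / T ^ 12 * (1 / T) := by
    field_simp
    push_cast
    ring
  rw [h6]
  have h7 : (2 : ℝ) / T ^ 12 ≤ 1 := by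
    rw [div_le_one (by positivity)]
    exact h5
  have h8 : 0 ≤ 1 / (T : ℝ) := by positivity
  nlinarith

/-- Off the bad event, the averages of all active balls are accurate. -/
theorem avgAccurate_of_notMem_badEvent (hT : 2 ≤ T) (hM : M.IsLipschitz) {ω : Ω}
    (ho : (A.transcript ω).Obeys T M.context) (hω : ω ∉ A.badEvent) :
    (A.transcript ω).AvgAccurate M T := by
  intro t ht j hj
  set h := A.transcript ω with hh
  have hjt := hj.le
  have hconf0 := h.conf_nonneg T t j
  -- For a ball never selected, the default average 0 is accurate because its confidence radius is
  -- at least 1.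
  rcases Nat.eq_zero_or_pos (h.count t j) with h0 | hpos
  · have h1 : h.avg t j = 0 := by rw [ZoomingTranscript.avg, h0]; simp
    have h2 : 1 ≤ h.conf T t j := by
      rw [ZoomingTranscript.conf, h0]
      have hlog : Real.log 2 ≤ Real.log T := Real.log_le_log (by norm_num) (by exact_mod_cast hT)
      have : (1 / 2 : ℝ) ≤ √(Real.log T / (1 + (0 : ℕ))) := by
        refine Real.le_sqrt_of_sq_le ?_
        have := Real.log_two_gt_d9
        norm_num
        linarith
      linarith
    have h3 := M.mean_nonneg (h.center j)
    have h4 := M.mean_le_one (h.center j)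
    have h5 := h.radius_pos j
    rw [h1, zero_sub, abs_neg, abs_of_nonneg h3]
    linarith
  have hn0 : (0 : ℝ) < h.count t j := by exact_mod_cast hpos
  have hcT : h.count t j ≤ T := by
    have : h.count t j ≤ (Finset.range t).card := Finset.card_filter_le _ _
    rw [Finset.card_range] at this
    omega
  have hdev : |A.dev j t ω| ≤ h.count t j * h.conf T t j := by
    simp only [badEvent, Set.mem_iUnion, not_exists] at hω
    have key : ∀ ε ∈ ({1, -1} : Finset ℝ),
        ε * A.dev j t ω < h.count t j * h.conf T t j := fun ε hε => by
      by_contra hcon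
      exact hω t (Finset.mem_range.2 ht) j (Finset.mem_range.2 (by omega)) (h.count t j)
        (Finset.mem_Icc.2 ⟨hpos, hcT⟩) ε hε ⟨rfl, not_lt.1 hcon⟩
    have k1 := key 1 (by simp)
    have k2 := key (-1) (by simp)
    exact abs_le.2 ⟨by linarith, by linarith⟩
  have hbias : |∑ s ∈ (Finset.range t).filter fun s => A.sel s ω = j,
      (M.mean (A.pt s ω) - M.mean (h.center j))| ≤ h.count t j * h.radius j := by
    refine (Finset.abs_sum_le_sum_abs _ _).trans ?_
    rw [← nsmul_eq_mul]
    refine Finset.sum_le_card_nsmul _ _ _ fun s hs => ?_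
    obtain ⟨hst, rfl⟩ := Finset.mem_filter.1 hs
    exact (hM _ _).trans (ho.dist_pt_le ((Finset.mem_range.1 hst).trans ht))
  -- The error splits into noise, controlled off the bad event, and bias, controlled by the
  -- Lipschitz condition within the ball.
  have hsplit : h.avg t j - M.mean (h.center j) = (A.dev j t ω +
      ∑ s ∈ (Finset.range t).filter fun s => A.sel s ω = j,
        (M.mean (A.pt s ω) - M.mean (h.center j))) / h.count t j := by
    rw [dev, ← Finset.sum_add_distrib]
    simp only [sub_add_sub_cancel]
    rw [Finset.sum_sub_distrib, Finset.sum_const, nsmul_eq_mul, sub_div]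
    congr 1
    exact (mul_div_cancel_left₀ _ hn0.ne').symm
  rw [hsplit, abs_div, abs_of_pos hn0, div_le_iff₀ hn0]
  refine (abs_add_le _ _).trans ?_
  linarith

end ZoomingExecution

/-! ### The bound in terms of the zooming dimension. -/

/-- The geometric sum of `2^{i a}` over the scales `2^{-i} ≥ r`, for `a ≥ 1`. -/
theorem tsum_dyadic_rpow_le {r a : ℝ} (hr : 0 < r) (ha : 1 ≤ a) :
    ∑' i : ℕ, (if r ≤ (1 / 2 : ℝ) ^ i then ENNReal.ofReal (((1 / 2 : ℝ) ^ i) ^ (-a)) else 0) ≤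
      ENNReal.ofReal (2 * r ^ (-a)) := by
  have hq2 : (2 : ℝ) ≤ 2 ^ a := by
    simpa using Real.rpow_le_rpow_of_exponent_le (by norm_num : (1 : ℝ) ≤ 2) ha
  have hpow : ∀ i : ℕ, ((1 / 2 : ℝ) ^ i) ^ (-a) = (2 ^ a) ^ i := fun i => by
    rw [one_div, inv_pow, Real.inv_rpow (by positivity), Real.rpow_neg (by positivity), inv_inv,
      ← Real.rpow_natCast_mul (by norm_num), mul_comm, Real.rpow_mul_natCast (by norm_num)]
  -- The ratio is at least 2 since `a ≥ 1`, so the sum is at most twice its last term, which is at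
  -- most `r^(-a)`.
  have hgeom : ∀ n : ℕ, ∑ i ∈ Finset.range n, ((2 : ℝ) ^ a) ^ i ≤ (2 ^ a) ^ n := fun n => by
    induction n with
    | zero => simp
    | succ n ih =>
      rw [Finset.sum_range_succ, pow_succ]
      have : (0 : ℝ) ≤ (2 ^ a) ^ n := by positivity
      nlinarith
  rw [ENNReal.tsum_eq_iSup_nat]
  refine iSup_le fun n => ?_
  induction n with
  | zero => simp
  | succ n ih =>
    by_cases h1 : r ≤ (1 / 2 : ℝ) ^ n
    · calc _ ≤ ∑ i ∈ Finset.range (n + 1), ENNReal.ofReal ((2 ^ a) ^ i) := by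
            refine Finset.sum_le_sum fun i _ => ?_
            split_ifs
            · rw [hpow]
            · exact zero_le
        _ = ENNReal.ofReal (∑ i ∈ Finset.range (n + 1), (2 ^ a) ^ i) :=
            (ENNReal.ofReal_sum_of_nonneg fun i _ => by positivity).symm
        _ ≤ _ := by
            refine ENNReal.ofReal_le_ofReal ?_
            have h2 := hgeom n
            have h3 := Real.rpow_le_rpow_of_nonpos hr h1 (by linarith : -a ≤ 0)
            rw [hpow] at h3
            rw [Finset.sum_range_succ]
            linarith
    · rw [Finset.sum_range_succ, if_neg h1, add_zero]
      exact ih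

namespace ContextualMAB

variable {X Y : Type*} {P : Set (X × Y)} [MeasurableSpace P] [MetricSpace P]
  {Φ : Type*} [MeasurableSpace Φ]

/-- For `r₀ ≤ 1` the scale 1 alone contributes at least `log T`; for `r₀ > 1` the first term is
large. This absorbs additive constants in the expected regret. -/
theorem half_le_zoomingBound (M : ContextualMAB P Φ) (p : P) {T : ℕ} (hT : 2 ≤ T) :
    ENNReal.ofReal (1 / 2) ≤ M.zoomingBound T := by
  have hT2 : (2 : ℝ) ≤ T := by exact_mod_cast hT
  have hlog : 1 / 2 ≤ Real.log T := by
    have : Real.log 2 ≤ Real.log T := Real.log_le_log (by norm_num) hT2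
    linarith [Real.log_two_gt_d9]
  refine le_iInf₂ fun r₀ hr₀ => ?_
  rcases le_or_gt r₀ 1 with h1 | h1
  · refine le_add_left (le_trans ?_ (ENNReal.le_tsum 0))
    have h2 : (1 : ℝ≥0∞) ≤ (M.zoomingNumber 1 : ℝ≥0∞) := by
      simpa using ENat.toENNReal_le.2 (M.one_le_zoomingNumber_one p)
    simp only [pow_zero, h1, if_true, div_one]
    calc ENNReal.ofReal (1 / 2) ≤ 1 * ENNReal.ofReal (Real.log T) := by
          rw [one_mul]
          exact ENNReal.ofReal_le_ofReal hlog
      _ ≤ _ := by gcongr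
  · refine le_add_right (ENNReal.ofReal_le_ofReal ?_)
    nlinarith

variable {M : ContextualMAB P Φ} {c d : ℝ}

theorem IsZoomingDim.nonneg (hd : M.IsZoomingDim c d) : 0 ≤ d :=
  hd.2 fun _ h => h.1.le

/-- The bound on the zooming numbers persists at the infimum. -/
theorem IsZoomingDim.zoomingNumber_le (hd : M.IsZoomingDim c d) {r : ℝ} (hr : 0 < r)
    (hr1 : r ≤ 1) : (M.zoomingNumber r : ℝ≥0∞) ≤ ENNReal.ofReal (c * r ^ (-d)) := by
  have hne : {d' : ℝ | 0 < d' ∧ ∀ r : ℝ, 0 < r → r ≤ 1 →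
      (M.zoomingNumber r : ℝ≥0∞) ≤ ENNReal.ofReal (c * r ^ (-d'))}.Nonempty := hd.nonempty
  obtain ⟨u, -, -, hu, humem⟩ := hd.exists_seq_antitone_tendsto hne
  have hcont : Filter.Tendsto (fun n => ENNReal.ofReal (c * r ^ (-u n))) Filter.atTop
      (nhds (ENNReal.ofReal (c * r ^ (-d)))) := by
    refine ENNReal.tendsto_ofReal (Filter.Tendsto.const_mul c ?_)
    exact ((Real.continuous_const_rpow hr.ne').tendsto _).comp hu.neg
  exact ge_of_tendsto' hcont fun n => (humem n).2 r hr hr1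

/-- Evaluate at scale 1, where the zooming number is at least 1. This lets the term `r₀ T`, which
carries no factor `c`, be absorbed. -/
theorem IsZoomingDim.one_le (hd : M.IsZoomingDim c d) (p : P) : 1 ≤ c := by
  have h1 := hd.zoomingNumber_le one_pos le_rfl
  have h2 : (1 : ℝ≥0∞) ≤ (M.zoomingNumber 1 : ℝ≥0∞) := by
    simpa using ENat.toENNReal_le.2 (M.one_le_zoomingNumber_one p)
  have h3 := h2.trans h1
  rwa [Real.one_rpow, mul_one, ENNReal.one_le_ofReal] at h3

open Classical in
/-- The regret bound in terms of the zooming dimension. -/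
theorem IsZoomingDim.zoomingBound_le (hd : M.IsZoomingDim c d) (p : P) {T : ℕ} (hT : 2 ≤ T) :
    M.zoomingBound T ≤
      ENNReal.ofReal (4 * (c * (T : ℝ) ^ (1 - 1 / (2 + d)) * Real.log T)) := by
  have hT2 : (2 : ℝ) ≤ T := by exact_mod_cast hT
  have hT0 : (0 : ℝ) < T := by linarith
  have hd0 := hd.nonneg
  have hc := hd.one_le p
  have hlog : 1 / 2 ≤ Real.log T := by
    have : Real.log 2 ≤ Real.log T := Real.log_le_log (by norm_num) hT2
    linarith [Real.log_two_gt_d9]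
  -- With this choice `r₀ T` and `r₀^(-(d+1))` coincide.
  set r₀ : ℝ := (T : ℝ) ^ (-(1 / (2 + d))) with hr₀
  have hr₀pos : 0 < r₀ := Real.rpow_pos_of_pos hT0 _
  have hfirst : r₀ * T = (T : ℝ) ^ (1 - 1 / (2 + d)) := by
    rw [hr₀, sub_eq_neg_add, Real.rpow_add hT0, Real.rpow_one]
  have hsecond : r₀ ^ (-(d + 1)) = (T : ℝ) ^ (1 - 1 / (2 + d)) := by
    rw [hr₀, ← Real.rpow_mul hT0.le]
    congr 1
    field_simp
    ring
  set K : ℝ := (T : ℝ) ^ (1 - 1 / (2 + d)) with hK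
  have hK0 : 0 ≤ K := Real.rpow_nonneg hT0.le _
  refine (iInf₂_le r₀ hr₀pos).trans ?_
  calc _ ≤ ENNReal.ofReal (r₀ * T) + ∑' i : ℕ, ENNReal.ofReal (c * Real.log T) *
        (if r₀ ≤ (1 / 2 : ℝ) ^ i then
          ENNReal.ofReal (((1 / 2 : ℝ) ^ i) ^ (-(d + 1))) else 0) := by
        gcongr with i
        split_ifs
        · have hpos : (0 : ℝ) < (1 / 2 : ℝ) ^ i := by positivity
          calc _ ≤ ENNReal.ofReal (c * ((1 / 2 : ℝ) ^ i) ^ (-d)) *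
                ENNReal.ofReal (Real.log T / (1 / 2 : ℝ) ^ i) := by
                gcongr
                exact hd.zoomingNumber_le hpos (pow_le_one₀ (by norm_num) (by norm_num))
            _ = _ := by
                rw [← ENNReal.ofReal_mul (by positivity), ← ENNReal.ofReal_mul (by positivity)]
                congr 1
                rw [neg_add, Real.rpow_add hpos, Real.rpow_neg_one]
                ring
        · simp
    _ ≤ ENNReal.ofReal (r₀ * T) + ENNReal.ofReal (c * Real.log T) *
        ENNReal.ofReal (2 * r₀ ^ (-(d + 1))) := by
        rw [ENNReal.tsum_mul_left]
        gcongr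
        exact tsum_dyadic_rpow_le hr₀pos (by linarith)
    _ ≤ _ := by
        rw [← ENNReal.ofReal_mul (by positivity), ← ENNReal.ofReal_add (by positivity)
          (by positivity), hfirst, hsecond]
        refine ENNReal.ofReal_le_ofReal ?_
        have h1 : 1 / 2 ≤ c * Real.log T := by nlinarith
        nlinarith

end ContextualMAB

/-! ### Regret with high probability and in expectation. -/

namespace ZoomingExecution

variable {X Y : Type*} {P : Set (X × Y)} [MeasurableSpace P] [MetricSpace P]
  {Φ : Type*} [MeasurableSpace Φ] {M : ContextualMAB P Φ} {T : ℕ}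
  {Ω : Type*} [MeasurableSpace Ω] {pr : Measure Ω} (A : ZoomingExecution M T pr)

theorem measurable_regret : Measurable A.regret := by
  unfold regret
  refine Finset.measurable_fun_sum _ fun t ht => ?_
  have hpt : Measurable (A.pt t) :=
    (A.measurable_pt t (Finset.mem_range.1 ht)).mono (A.past.le t) le_rfl
  exact (M.measurable_mean.comp hpt).const_sub _

theorem abs_regret_le (ω : Ω) : |A.regret ω| ≤ T := by
  unfold regret
  refine (Finset.abs_sum_le_sum_abs _ _).trans ?_
  calc _ ≤ ∑ t ∈ Finset.range T, (1 : ℝ) := by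
        refine Finset.sum_le_sum fun t _ => ?_
        have h1 := M.bestMean_le_one (M.context t)
        have h2 := M.bestMean_nonneg (M.context t)
        have h3 := M.mean_nonneg (A.pt t ω)
        have h4 := M.mean_le_one (A.pt t ω)
        exact abs_le.2 ⟨by linarith, by linarith⟩
    _ = T := by simp

theorem integrable_regret [IsProbabilityMeasure pr] : Integrable A.regret pr :=
  Integrable.of_bound A.measurable_regret.aestronglyMeasurable T
    (ae_of_all _ fun ω => A.abs_regret_le ω)

theorem regret_le_of_notMem_badEvent (hM : M.IsLipschitz) (hT : 2 ≤ T) {ω : Ω}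
    (ho : (A.transcript ω).Obeys T M.context) (hω : ω ∉ A.badEvent) :
    ENNReal.ofReal (A.regret ω) ≤ 270 * M.zoomingBound T := by
  have heq : A.regret ω = ∑ t ∈ Finset.range T, M.badness ((A.transcript ω).pt t) :=
    Finset.sum_congr rfl fun t ht => by
      rw [ContextualMAB.badness, (ho.2 t (Finset.mem_range.1 ht)).2.2.2]
      rfl
  rw [heq]
  exact (A.avgAccurate_of_notMem_badEvent hT hM ho hω).sum_badness_le hM ho hT

/-- The regret bound fails with probability at most `1 / T`. -/
theorem measure_regret_gt_le [IsProbabilityMeasure pr] (hM : M.IsLipschitz) (hT : 2 ≤ T) :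
    pr.real {ω | ENNReal.ofReal (A.regret ω) ≤ 270 * M.zoomingBound T}ᶜ ≤ 1 / T := by
  have hle : pr {ω | ENNReal.ofReal (A.regret ω) ≤ 270 * M.zoomingBound T}ᶜ ≤ pr A.badEvent := by
    refine measure_mono_ae ?_
    filter_upwards [A.obeys] with ω ho hω
    by_contra hbad
    exact hω (A.regret_le_of_notMem_badEvent hM hT ho hbad)
  exact ENNReal.toReal_le_of_le_ofReal (by positivity) (hle.trans (A.measure_badEvent_le hT))

theorem integral_regret_le [IsProbabilityMeasure pr] (hM : M.IsLipschitz) (hT : 2 ≤ T) :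
    ENNReal.ofReal (∫ ω, A.regret ω ∂pr) ≤ 272 * M.zoomingBound T := by
  have hT0 : (0 : ℝ) < T := by exact_mod_cast (by omega : 0 < T)
  -- An infinite bound is treated apart, since its `toReal` would be 0.
  rcases eq_or_ne (M.zoomingBound T) ⊤ with htop | htop
  · rw [htop, ENNReal.mul_top (by norm_num)]
    exact le_top
  set S := {ω | ENNReal.ofReal (A.regret ω) ≤ 270 * M.zoomingBound T} with hS
  set K := (270 * M.zoomingBound T).toReal with hK
  have hfin : 270 * M.zoomingBound T ≠ ⊤ := ENNReal.mul_ne_top (by norm_num) htop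
  have hSm : MeasurableSet S :=
    (ENNReal.measurable_ofReal.comp A.measurable_regret) measurableSet_Iic
  -- On the complement of `S`, of probability at most 1/T, the trivial bound `T` costs at most 1 in
  -- expectation; this raises 270 to 272.
  have hpt : ∀ ω, A.regret ω ≤ K + Sᶜ.indicator (fun _ => (T : ℝ)) ω := by
    intro ω
    have hK0 : 0 ≤ K := ENNReal.toReal_nonneg
    by_cases hω : ω ∈ S
    · rw [Set.indicator_of_notMem (by simpa using hω), add_zero]
      exact (ENNReal.ofReal_le_iff_le_toReal hfin).1 hω
    · rw [Set.indicator_of_mem (by simpa using hω)]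
      linarith [(abs_le.1 (A.abs_regret_le ω)).2]
  have hint : Integrable (fun ω => Sᶜ.indicator (fun _ => (T : ℝ)) ω) pr :=
    (integrable_const _).indicator hSm.compl
  have h1 : ∫ ω, A.regret ω ∂pr ≤ K + 1 := by
    refine (integral_mono A.integrable_regret ((integrable_const K).add hint) hpt).trans ?_
    simp only [Pi.add_apply]
    rw [integral_add (integrable_const K) hint, integral_indicator_const _ hSm.compl]
    have h2 := A.measure_regret_gt_le hM hT
    have h3 : pr.real Sᶜ * T ≤ 1 := by
      rwa [le_div_iff₀ hT0] at h2
    simpa using h3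
  calc ENNReal.ofReal (∫ ω, A.regret ω ∂pr) ≤ ENNReal.ofReal (K + 1) :=
        ENNReal.ofReal_le_ofReal h1
    _ = 270 * M.zoomingBound T + 2 * ENNReal.ofReal (1 / 2) := by
        rw [ENNReal.ofReal_add ENNReal.toReal_nonneg zero_le_one, ENNReal.ofReal_toReal hfin]
        congr 1
        rw [← ENNReal.ofReal_ofNat 2, ← ENNReal.ofReal_mul (by norm_num)]
        norm_num
    _ ≤ 270 * M.zoomingBound T + 2 * M.zoomingBound T := by
        gcongr
        exact M.half_le_zoomingBound A.start hT
    _ = 272 * M.zoomingBound T := by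
        rw [← add_mul]
        norm_num

end ZoomingExecution

theorem theorem1 :
    ∃ C₁ C₂ : ℝ≥0,
      ∀ {X Y : Type*} (P : Set (X × Y)) [MeasurableSpace P] [MetricSpace P]
        {Φ : Type*} [MeasurableSpace Φ] (M : ContextualMAB P Φ), M.IsLipschitz →
      ∀ (T : ℕ), 2 ≤ T →
      ∀ {Ω : Type*} [MeasurableSpace Ω] (pr : Measure Ω) [IsProbabilityMeasure pr]
        (A : ZoomingExecution M T pr),
        (1 - 1 / (T : ℝ) ≤
          pr.real {ω | ENNReal.ofReal (A.regret ω) ≤ C₁ * M.zoomingBound T}) ∧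
        (Integrable A.regret pr ∧
          ENNReal.ofReal (∫ ω, A.regret ω ∂pr) ≤ C₁ * M.zoomingBound T) ∧
        (∀ c d : ℝ, 0 < c → M.IsZoomingDim c d →
          C₁ * M.zoomingBound T ≤
            ENNReal.ofReal (C₂ * (c * (T : ℝ) ^ (1 - 1 / (2 + d)) * Real.log T))) := by
  refine ⟨272, 272 * 4, ?_⟩
  intro X Y P _ _ Φ _ M hM T hT Ω _ pr _ A
  refine ⟨?_, ⟨A.integrable_regret, by simpa using A.integral_regret_le hM hT⟩, ?_⟩
  · have hSm : MeasurableSet {ω | ENNReal.ofReal (A.regret ω) ≤ 270 * M.zoomingBound T} :=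
      (ENNReal.measurable_ofReal.comp A.measurable_regret) measurableSet_Iic
    have h1 := A.measure_regret_gt_le hM hT
    rw [probReal_compl_eq_one_sub hSm] at h1
    have h2 : pr.real {ω | ENNReal.ofReal (A.regret ω) ≤ 270 * M.zoomingBound T} ≤
        pr.real {ω | ENNReal.ofReal (A.regret ω) ≤ (272 : ℝ≥0) * M.zoomingBound T} := by
      have hle : 270 * M.zoomingBound T ≤ (272 : ℝ≥0) * M.zoomingBound T := by
        gcongr
        exact_mod_cast (by norm_num : (270 : ℝ≥0) ≤ 272)
      exact measureReal_mono fun ω (hω : _ ≤ _) => hω.trans hle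
    linarith
  · intro c d _ hd
    have h1 := hd.zoomingBound_le A.start hT
    calc ((272 : ℝ≥0) : ℝ≥0∞) * M.zoomingBound T ≤ ENNReal.ofReal 272 * ENNReal.ofReal
          (4 * (c * (T : ℝ) ^ (1 - 1 / (2 + d)) * Real.log T)) := by
          gcongr
          norm_num
      _ = _ := by
          rw [← ENNReal.ofReal_mul (by norm_num)]
          congr 1
          push_cast
          ring
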